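/- Let $(A,[\cdot,\cdot],\rho)$ be a Lie algebroid over a smooth manifold $M$ (finite-dimensional, Hausdorff, without boundary): $A\to M$ is a smooth vector bundle of finite rank, $\rho:A\to TM$ is a smooth bundle map (the anchor), and $[\cdot,\cdot]$ is a Lie bracket on $\Gamma(A)$ with $\rho[u,v]=[\rho u,\rho v]$ and $[u,fv]=f[u,v]+(\rho(u)f)v$ for $u,v\in\Gamma(A)$, $f\in C^\infty(M)$. Let $p:A^*\to M$ be the dual bundle, and for $u\in\Gamma(A)$ let $l_u\in C^\infty(A^*)$ be the function $l_u(\alpha)=\langle\alpha,u(p(\alpha))\rangle$. Equip $A^*$ with its Lie–Poisson structure $\pi$, that is, the bivector field whose bracket $\{F,G\}=\pi(dF,dG)$ is determined by $$\{l_u,l_v\}=l_{[u,v]},\qquad \{l_u,p^*f\}=p^*(\rho(u)f),\qquad \{p^*f,p^*g\}=0 .$$ A vector field $X$ on $A^*$ is called Poisson if $L_X\pi=0$, and Hamiltonian if $X=X_K:=\{K,\cdot\}$ for some $K\in C^\infty(A^*)$. For a smooth 1-form $\gamma\in\Omega^1(M)$ let $\mathrm{ad}(\gamma)$ be the vertical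 vector field $-\rho^*\gamma$ on $A^*$, i.e. $\mathrm{ad}(\gamma)(\alpha)=\frac{d}{dt}\big|_{t=0}\big(\alpha-t\,\rho^*(\gamma_x)\big)$ for $\alpha\in A^*_x$. Then: 1. $\mathrm{ad}(\gamma)$ is a Poisson vector field if and only if $\rho^*(d\gamma)=0$ in $\Gamma(\wedge^2A^*)$, i.e. $d\gamma(\rho a,\rho b)=0$ for all $x\in M$ and $a,b\in A_x$. 2. $\mathrm{ad}(\gamma)$ is a Hamiltonian vector field if and only if $\rho^*\gamma=\rho^*(df)$ for some $f\in C^\infty(M)$. 3. If $A$ is transitive, i.e. $\rho_x:A_x\to T_xM$ is surjective for every $x\in M$, then $\mathrm{ad}(\gamma)$ is Poisson if and only if $\gamma$ is closed ($d\gamma=0$), and Hamiltonian if and only if $\gamma$ is exact ($\gamma=df$ for some $f\in C^\infty(M)$). -/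

import Mathlib

open scoped Manifold ContDiff Bundle

noncomputable section

section BivectorFields

variable {EN : Type*} [NormedAddCommGroup EN] [NormedSpace ℝ EN] {HN : Type*} [TopologicalSpace HN]
  (J : ModelWithCorners ℝ EN HN) {N : Type*} [TopologicalSpace N] [ChartedSpace HN N]

/-- The cotangent space of `N` at `p`. -/
abbrev Cotangent (p : N) : Type _ := TangentSpace J p →L[ℝ] ℝ

/-- The differential at `p` of a real function on `N`, as a cotangent vector. -/
def diffAt (f : N → ℝ) (p : N) : Cotangent J p := mfderiv J 𝓘(ℝ, ℝ) f p

/-- The derivative `X f` of a real function along a vector field. -/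
def derivAlong (X : (p : N) → TangentSpace J p) (f : N → ℝ) (p : N) : ℝ := diffAt J f p (X p)

/-- The Lie derivative `L_X P` of a field of bilinear forms on the cotangent spaces (such as a
bivector field), evaluated on `dF, dG`:
`(L_X P)(dF, dG) = X (P(dF, dG)) - P(L_X dF, dG) - P(dF, L_X dG)`, where `L_X dF = d(X F)`. -/
def lieDerivBivector (X : (p : N) → TangentSpace J p)
    (P : (p : N) → Cotangent J p → Cotangent J p → ℝ) (F G : N → ℝ) (p : N) : ℝ :=
  derivAlong J X (fun q => P q (diffAt J F q) (diffAt J G q)) p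
    - P p (diffAt J (derivAlong J X F) p) (diffAt J G p)
    - P p (diffAt J F p) (diffAt J (derivAlong J X G) p)

/-- `X` is a Poisson vector field for `P` if `L_X P = 0`. (The differentials of globally defined
smooth functions span every cotangent space.) -/
def IsPoissonVectorField (P : (p : N) → Cotangent J p → Cotangent J p → ℝ)
    (X : (p : N) → TangentSpace J p) : Prop :=
  ∀ F G : C^∞⟮J, N; ℝ⟯, ∀ p : N, lieDerivBivector J X P F G p = 0

/-- `X` is a Hamiltonian vector field for `P` if `X = P(dK, ·)` for some smooth function `K`,
that is, `X G = {K, G}`. -/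
def IsHamiltonianVectorField (P : (p : N) → Cotangent J p → Cotangent J p → ℝ)
    (X : (p : N) → TangentSpace J p) : Prop :=
  ∃ K : C^∞⟮J, N; ℝ⟯, ∀ (p : N) (ψ : Cotangent J p), ψ (X p) = P p (diffAt J K p) ψ

end BivectorFields

section OneForms

variable {E : Type*} [NormedAddCommGroup E] [NormedSpace ℝ E] {H : Type*} [TopologicalSpace H]
  (I : ModelWithCorners ℝ E H) (M : Type*) [TopologicalSpace M] [ChartedSpace H M]
  [IsManifold I ∞ M]

/-- Smooth 1-forms on `M`: smooth sections of the cotangent bundle. -/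
abbrev OneForm : Type _ :=
  ContMDiffSection I (E →L[ℝ] ℝ) ∞ (fun x : M => TangentSpace I x →L[ℝ] Bundle.Trivial M ℝ x)

variable {I M}

/-- The coordinate expression of a 1-form in the preferred chart at `x`: its pullback under the
inverse of that chart (`M` is meant to have no boundary, so `y` ranges over an open set of `E`). -/
def OneForm.inChart (γ : OneForm I M) (x : M) (y : E) : E →L[ℝ] ℝ :=
  (γ ((extChartAt I x).symm y)).comp (mfderiv 𝓘(ℝ, E) I (extChartAt I x).symm y)

/-- The exterior derivative `dγ` at `x`, computed in the preferred chart at `x` (through which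
Mathlib identifies `T_x M` with `E`): `dγ(v, w) = ∂_v (γ w) - ∂_w (γ v)` for constant `v, w`. -/
def OneForm.extDerivAt (γ : OneForm I M) (x : M) (v w : TangentSpace I x) : ℝ :=
  (fderiv ℝ (γ.inChart x) (extChartAt I x x) v : E →L[ℝ] ℝ) w
    - (fderiv ℝ (γ.inChart x) (extChartAt I x x) w : E →L[ℝ] ℝ) v

/-- `γ` is closed: `dγ = 0`. -/
def OneForm.IsClosed (γ : OneForm I M) : Prop :=
  ∀ (x : M) (v w : TangentSpace I x), γ.extDerivAt x v w = 0

/-- `γ` is exact: `γ = df` for a smooth function `f`. -/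
def OneForm.IsExact (γ : OneForm I M) : Prop :=
  ∃ f : C^∞⟮I, M; ℝ⟯, ∀ (x : M) (v : TangentSpace I x), γ x v = diffAt I f x v

end OneForms

section LieAlgebroids

variable {E : Type*} [NormedAddCommGroup E] [NormedSpace ℝ E] {H : Type*} [TopologicalSpace H]
  (I : ModelWithCorners ℝ E H) {M : Type*} [TopologicalSpace M] [ChartedSpace H M]
  [IsManifold I ∞ M]
  (F : Type*) [NormedAddCommGroup F] [NormedSpace ℝ F]
  (V : M → Type*) [TopologicalSpace (Bundle.TotalSpace F V)]
  [∀ x, AddCommGroup (V x)] [∀ x, Module ℝ (V x)] [∀ x, TopologicalSpace (V x)]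
  [FiberBundle F V] [VectorBundle ℝ F V]

/-- A Lie algebroid structure on the smooth vector bundle `V` over `M`: a smooth bundle map
`ρ : V → TM` (the anchor) and a Lie bracket on the space of smooth sections such that
`ρ [u, v] = [ρ u, ρ v]` and `[u, f v] = f [u, v] + (ρ(u) f) v`. -/
structure LieAlgebroid where
  anchor : ContMDiffSection I (F →L[ℝ] E) ∞ (fun x : M => V x →L[ℝ] TangentSpace I x)
  bracket : Cₛ^∞⟮I; F, V⟯ →ₗ[ℝ] Cₛ^∞⟮I; F, V⟯ →ₗ[ℝ] Cₛ^∞⟮I; F, V⟯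
  bracket_self : ∀ u, bracket u u = 0
  jacobi : ∀ u v w,
    bracket u (bracket v w) + bracket v (bracket w u) + bracket w (bracket u v) = 0
  anchor_bracket : ∀ u v (x : M), anchor x (bracket u v x) =
    VectorField.mlieBracket I (fun y => anchor y (u y)) (fun y => anchor y (v y)) x
  leibniz : ∀ (u v fv : Cₛ^∞⟮I; F, V⟯) (f : C^∞⟮I, M; ℝ⟯), (∀ x, fv x = f x • v x) →
    ∀ x, bracket u fv x = f x • bracket u v x + diffAt I f x (anchor x (u x)) • v x

/-- The total space of the dual bundle `V*`. It is a smooth manifold modelled on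
`dualModel I F`. -/
abbrev DualTotal : Type _ :=
  Bundle.TotalSpace (F →L[ℝ] ℝ) (fun x : M => V x →L[ℝ] Bundle.Trivial M ℝ x)

/-- The model with corners of the manifold `V*`. -/
abbrev dualModel : ModelWithCorners ℝ (E × (F →L[ℝ] ℝ)) (ModelProd H (F →L[ℝ] ℝ)) :=
  I.prod 𝓘(ℝ, F →L[ℝ] ℝ)

variable {I F V}

/-- The fibrewise linear function `l_u` on `V*` defined by a section `u`: `l_u(α) = ⟨α, u⟩`. -/
def linearFun (u : Cₛ^∞⟮I; F, V⟯) (α : DualTotal F V) : ℝ := α.2 (u α.1)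

namespace LieAlgebroid

variable (A : LieAlgebroid I F V)

/-- `A` is transitive if its anchor is fibrewise surjective. -/
def IsTransitive : Prop := ∀ x : M, Function.Surjective (A.anchor x)

/-- The pullback `ρ*θ ∈ V_x*` of a cotangent vector `θ` at `x` by the anchor. -/
def anchorDual (x : M) (θ : TangentSpace I x →L[ℝ] ℝ) : V x →L[ℝ] ℝ := θ.comp (A.anchor x)

/-- The Lie-Poisson bivector on `V*`. Every pair of cotangent vectors at `α` is of the form
`φ = d(l_u + p*f)`, `ψ = d(l_v + p*g)` at `α` with sections `u, v` and smooth functions `f, g` on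
the base, and then `π(φ, ψ) = l_[u,v] + p*(ρ(u) g) - p*(ρ(v) f)` at `α`, whatever the choice of
`u, v, f, g`. These are the relations
`{l_u, l_v} = l_[u,v]`, `{l_u, p*g} = p*(ρ(u) g)`, `{p*f, p*g} = 0`. -/
def liePoisson (α : DualTotal F V) (φ ψ : Cotangent (dualModel I F) α) : ℝ :=
  open Classical in
  if h : ∃ r : (Cₛ^∞⟮I; F, V⟯ × C^∞⟮I, M; ℝ⟯) × (Cₛ^∞⟮I; F, V⟯ × C^∞⟮I, M; ℝ⟯),
      φ = diffAt (dualModel I F) (fun β => linearFun r.1.1 β + r.1.2 β.1) α ∧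
      ψ = diffAt (dualModel I F) (fun β => linearFun r.2.1 β + r.2.2 β.1) α then
    linearFun (A.bracket h.choose.1.1 h.choose.2.1) α
      + diffAt I h.choose.2.2 α.1 (A.anchor α.1 (h.choose.1.1 α.1))
      - diffAt I h.choose.1.2 α.1 (A.anchor α.1 (h.choose.2.1 α.1))
  else 0

/-- The vertical vector field `ad(γ) = -ρ*γ` on `V*`: the fundamental vector field
`α ↦ d/dt|_{t=0} (α - t ρ*γ)` of the vertical translations of `V*` by `-ρ*γ`. -/
def verticalField (γ : OneForm I M) (α : DualTotal F V) : TangentSpace (dualModel I F) α :=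
  mfderiv 𝓘(ℝ, ℝ) (dualModel I F)
    (fun t : ℝ => (⟨α.1, α.2 - t • A.anchorDual α.1 (γ α.1)⟩ : DualTotal F V)) 0 (1 : ℝ)

end LieAlgebroid

end LieAlgebroids

end

/-!
Let `x` be the base point of `α`. The fibrewise affine functions `l_u + p*f` carry the whole
argument. Their brackets are given by the defining relations of the Lie-Poisson structure, their
differentials at `α` fill the cotangent space (`affineDiff_surjective`), and near `α` they include
chart coordinates of the dual bundle (`exists_affineFun_eventuallyEq`). The bracket of two affine
functions at `α` depends only on their differentials there: if `l_u + p*f` is critical at `α`, then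
`u` vanishes at `x`, so that by the Leibniz rule `[v, u](x)` is the derivative along `ρ(v)` of the
coefficients of `u` in a local frame, and criticality of `l_u + p*f` along a section of the dual
bundle through `α` that is constant in that frame says that this derivative, paired with `α`, is
`-ρ(v) f` (`LieAlgebroid.linearFun_bracket_add_eq_zero`). Hence `liePoisson` is a field of bilinear
forms with the expected values on affine functions (`LieAlgebroid.liePoisson_affineDiff`,
`LieAlgebroid.liePoisson_bilinear`).

For `X = ad(γ)` one has `X (l_u + p*f) = -p*(γ(ρ u))`. So on `l_u + p*f` and `l_v + p*g` the
Lie derivative `L_X π` takes the value `ρ(u) γ(ρ v) - ρ(v) γ(ρ u) - γ(ρ [u, v])`, which is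
`dγ(ρ u, ρ v)` by the invariant formula for the exterior derivative
(`OneForm.extDerivAt_apply_vectorField`, `LieAlgebroid.lieDerivBivector_affineFun`). Since `L_X π`
is a tensor, its vanishing on affine functions, which contain coordinates, is enough for `X` to be
Poisson (`lieDerivBivector_eq_zero_of_coordinates`).

If `ρ*γ = ρ*(df)`, then `X` is the Hamiltonian vector field of `p*f`. Conversely, if `X` is the
Hamiltonian vector field of `K`, then evaluating `X l_v = {K, l_v}` along the zero section, where
the linear functions vanish, gives `γ(ρ v) = ρ(v) f` with `f` the restriction of `K` to the zero
section.
-/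

open Filter Topology Module

/-! ### Differentials of functions and tensoriality of the Lie derivative -/

section Differentials

variable {EN : Type*} [NormedAddCommGroup EN] [NormedSpace ℝ EN] {HN : Type*} [TopologicalSpace HN]
  {J : ModelWithCorners ℝ EN HN} {N : Type*} [TopologicalSpace N] [ChartedSpace HN N]
  {f g : N → ℝ} {p : N}

theorem diffAt_congr (h : f =ᶠ[𝓝 p] g) : diffAt J f p = diffAt J g p :=
  h.mfderiv_eq

theorem diffAt_add (hf : MDifferentiableAt J 𝓘(ℝ, ℝ) f p) (hg : MDifferentiableAt J 𝓘(ℝ, ℝ) g p) :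
    diffAt J (fun q => f q + g q) p = diffAt J f p + diffAt J g p :=
  mfderiv_add hf hg

theorem diffAt_mul (hf : MDifferentiableAt J 𝓘(ℝ, ℝ) f p) (hg : MDifferentiableAt J 𝓘(ℝ, ℝ) g p) :
    diffAt J (fun q => f q * g q) p = f p • diffAt J g p + g p • diffAt J f p :=
  (hf.hasMFDerivAt.mul hg.hasMFDerivAt).mfderiv

theorem diffAt_const (c : ℝ) : diffAt J (fun _ : N => c) p = 0 :=
  mfderiv_const

theorem diffAt_const_mul (c : ℝ) (hf : MDifferentiableAt J 𝓘(ℝ, ℝ) f p) :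
    diffAt J (fun q => c * f q) p = c • diffAt J f p :=
  const_smul_mfderiv hf c

theorem diffAt_neg : diffAt J (fun q => -f q) p = -diffAt J f p :=
  mfderiv_neg (f := f)

theorem mdifferentiableAt_finset_sum {ι : Type*} (s : Finset ι) {f : ι → N → ℝ}
    (hf : ∀ i, MDifferentiableAt J 𝓘(ℝ, ℝ) (f i) p) :
    MDifferentiableAt J 𝓘(ℝ, ℝ) (fun q => ∑ i ∈ s, f i q) p := by
  classical
  induction s using Finset.induction_on with
  | empty => simpa using mdifferentiableAt_const
  | insert i s hi ih =>
    simp only [Finset.sum_insert hi]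
    exact (hf i).add ih

theorem diffAt_sum {ι : Type*} (s : Finset ι) {f : ι → N → ℝ}
    (hf : ∀ i, MDifferentiableAt J 𝓘(ℝ, ℝ) (f i) p) :
    diffAt J (fun q => ∑ i ∈ s, f i q) p = ∑ i ∈ s, diffAt J (f i) p := by
  classical
  induction s using Finset.induction_on with
  | empty => simpa using diffAt_const 0
  | insert i s hi ih =>
    simp only [Finset.sum_insert hi]
    rw [diffAt_add (hf i) (mdifferentiableAt_finset_sum s hf), ih]

theorem diffAt_comp_apply {EM : Type*} [NormedAddCommGroup EM] [NormedSpace ℝ EM] {HM : Type*}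
    [TopologicalSpace HM] {K : ModelWithCorners ℝ EM HM} {M : Type*} [TopologicalSpace M]
    [ChartedSpace HM M] {h : M → N} {x : M} (hf : MDifferentiableAt J 𝓘(ℝ, ℝ) f (h x))
    (hh : MDifferentiableAt K J h x) (v : TangentSpace K x) :
    diffAt K (fun y => f (h y)) x v = diffAt J f (h x) (mfderiv K J h x v) :=
  mfderiv_comp_apply x hf hh v

theorem diffAt_eq_fderiv [J.Boundaryless] (hf : MDifferentiableAt J 𝓘(ℝ, ℝ) f p) :
    diffAt J f p = fderiv ℝ (f ∘ (extChartAt J p).symm) (extChartAt J p p) := by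
  have h := hf.mfderiv
  simp only [J.range_eq_univ, fderivWithin_univ] at h
  exact h

variable [J.Boundaryless] [IsManifold J ∞ N]

theorem eventually_contDiffAt_comp_extChartAt_symm (F : C^∞⟮J, N; ℝ⟯) (p : N) :
    ∀ᶠ q in 𝓝 p, ContDiffAt ℝ ∞ (F ∘ (extChartAt J p).symm) (extChartAt J p q) := by
  filter_upwards [(isOpen_extChartAt_source (I := J) p).mem_nhds (mem_extChartAt_source p)]
    with q hq
  have h : ContMDiffOn 𝓘(ℝ, EN) 𝓘(ℝ, ℝ) ∞ (F ∘ (extChartAt J p).symm) (extChartAt J p).target :=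
    F.contMDiff.comp_contMDiffOn (contMDiffOn_extChartAt_symm p)
  exact (contMDiffOn_iff_contDiffOn.1 h).contDiffAt
    ((isOpen_extChartAt_target p).mem_nhds ((extChartAt J p).map_source hq))

/-- The differential of a smooth function in chart coordinates `y k`: near `p`,
`dF = ∑ k, c k • d(y k)` with differentiable coefficients, and `∑ k, d(c k) ∧ d(y k)` vanishes at
`p` because second derivatives are symmetric (this is `d(dF) = 0`). -/
theorem exists_diffAt_eq_sum {ι : Type*} [Fintype ι] (b : Basis ι ℝ EN) {p : N} {y : ι → N → ℝ}
    (hy : ∀ k, ∀ᶠ q in 𝓝 p, y k q = b.equivFunL (extChartAt J p q) k)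
    (F : C^∞⟮J, N; ℝ⟯) :
    ∃ c : ι → N → ℝ, (∀ k, MDifferentiableAt J 𝓘(ℝ, ℝ) (c k) p) ∧
      (∀ᶠ q in 𝓝 p, diffAt J F q = ∑ k, c k q • diffAt J (y k) q) ∧
      ∀ v w : TangentSpace J p, ∑ k, diffAt J (c k) p v * diffAt J (y k) p w =
        ∑ k, diffAt J (c k) p w * diffAt J (y k) p v := by
  set φ := extChartAt J p with hφ
  set Ft : EN → ℝ := F ∘ φ.symm with hFt
  have hsmooth := eventually_contDiffAt_comp_extChartAt_symm F p
  have hφd : ∀ᶠ q in 𝓝 p, MDifferentiableAt J 𝓘(ℝ, EN) φ q := by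
    filter_upwards [(isOpen_extChartAt_source (I := J) p).mem_nhds (mem_extChartAt_source p)]
      with q hq
    exact mdifferentiableAt_extChartAt (by simpa using hq)
  obtain ⟨D, hchain⟩ : ∃ D : (q : N) → TangentSpace J q →L[ℝ] EN, ∀ (g : EN → ℝ) (q : N),
      DifferentiableAt ℝ g (φ q) → MDifferentiableAt J 𝓘(ℝ, EN) φ q → ∀ v : TangentSpace J q,
      diffAt J (fun q => g (φ q)) q v = fderiv ℝ g (φ q) (D q v) := by
    refine ⟨fun q => mfderiv J 𝓘(ℝ, EN) φ q, fun g q hg hq v => ?_⟩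
    have h : diffAt 𝓘(ℝ, EN) g (φ q) = fderiv ℝ g (φ q) := mfderiv_eq_fderiv
    exact (diffAt_comp_apply (J := 𝓘(ℝ, EN)) hg.mdifferentiableAt hq v).trans
      (DFunLike.congr_fun h _)
  have hyd : ∀ᶠ q in 𝓝 p, ∀ k, ∀ v : TangentSpace J q,
      diffAt J (y k) q v = b.equivFunL (D q v) k := by
    have hy' : ∀ᶠ q in 𝓝 p, ∀ k, (y k) =ᶠ[𝓝 q] fun q => b.equivFunL (φ q) k :=
      eventually_all.2 fun k => (hy k).eventually_nhds
    filter_upwards [hy', hφd] with q hq hqd k v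
    let L : EN →L[ℝ] ℝ := (ContinuousLinearMap.proj k).comp b.equivFunL.toContinuousLinearMap
    have := hchain L q L.differentiableAt hqd v
    rw [L.fderiv] at this
    rw [diffAt_congr (hq k)]
    exact this
  have hsum : ∀ (L : EN →L[ℝ] ℝ) (z : EN), ∑ k, L (b k) * b.equivFunL z k = L z := by
    intro L z
    conv_rhs => rw [← b.sum_equivFun z, map_sum]
    simp [mul_comm]
  have hp2 : ContDiffAt ℝ ∞ Ft (φ p) := hsmooth.self_of_nhds
  have hfd : DifferentiableAt ℝ (fderiv ℝ Ft) (φ p) :=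
    (hp2.fderiv_right (m := 1) (by norm_cast)).differentiableAt (by norm_num)
  refine ⟨fun k q => fderiv ℝ Ft (φ q) (b k), fun k => ?_, ?_, fun v w => ?_⟩
  · have : DifferentiableAt ℝ (fun z => fderiv ℝ Ft z (b k)) (φ p) :=
      hfd.clm_apply (differentiableAt_const _)
    exact this.mdifferentiableAt.comp p hφd.self_of_nhds
  · filter_upwards [hsmooth, hφd, hyd,
      ((isOpen_extChartAt_source (I := J) p).mem_nhds (mem_extChartAt_source p))] with q h1 h2 h3 h4
    ext v
    have hF : (F : N → ℝ) =ᶠ[𝓝 q] fun q => Ft (φ q) := by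
      filter_upwards [(isOpen_extChartAt_source (I := J) p).mem_nhds h4] with r hr
      simp [hFt, φ.left_inv hr]
    rw [diffAt_congr hF, hchain Ft q (h1.differentiableAt (by simp)) h2 v]
    simp only [sum_apply, smul_apply, h3, smul_eq_mul]
    exact (hsum _ _).symm
  · have hc : ∀ k (v : TangentSpace J p), diffAt J (fun q => fderiv ℝ Ft (φ q) (b k)) p v =
        fderiv ℝ (fderiv ℝ Ft) (φ p) (D p v) (b k) := by
      intro k v
      rw [hchain (fun z => fderiv ℝ Ft z (b k)) p (hfd.clm_apply (differentiableAt_const _))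
        hφd.self_of_nhds v, fderiv_clm_apply hfd (differentiableAt_const _)]
      simp [ContinuousLinearMap.flip_apply]
    have hsymm : IsSymmSndFDerivAt ℝ Ft (φ p) :=
      hp2.isSymmSndFDerivAt (by rw [minSmoothness_of_isRCLikeNormedField]; norm_cast)
    simp only [hc, hyd.self_of_nhds]
    rw [hsum (fderiv ℝ (fderiv ℝ Ft) (φ p) _), hsum (fderiv ℝ (fderiv ℝ Ft) (φ p) _)]
    exact hsymm _ _

/-- `L_X P` is a tensor: at `p` it vanishes on all smooth functions as soon as it vanishes on a
system of chart coordinates. -/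
theorem lieDerivBivector_eq_zero_of_coordinates {X : (p : N) → TangentSpace J p}
    {P : (p : N) → Cotangent J p → Cotangent J p → ℝ}
    (hP : ∀ q, ∃ B : Cotangent J q →ₗ[ℝ] Cotangent J q →ₗ[ℝ] ℝ, ∀ φ ψ, P q φ ψ = B φ ψ)
    {ι : Type*} [Fintype ι] (b : Basis ι ℝ EN) {p : N} {y : ι → N → ℝ}
    (hy : ∀ k, ∀ᶠ q in 𝓝 p, y k q = b.equivFunL (extChartAt J p q) k)
    (hPy : ∀ k l, MDifferentiableAt J 𝓘(ℝ, ℝ)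
      (fun q => P q (diffAt J (y k) q) (diffAt J (y l) q)) p)
    (hXy : ∀ k, MDifferentiableAt J 𝓘(ℝ, ℝ) (derivAlong J X (y k)) p)
    (h0 : ∀ k l, lieDerivBivector J X P (y k) (y l) p = 0) (F G : C^∞⟮J, N; ℝ⟯) :
    lieDerivBivector J X P F G p = 0 := by
  choose B hB using hP
  obtain rfl : P = fun q φ ψ => B q φ ψ := by
    funext q φ ψ
    exact hB q φ ψ
  clear hB
  obtain ⟨c, hc, hcF, hcs⟩ := exists_diffAt_eq_sum b hy F
  obtain ⟨d, hd, hdG, hds⟩ := exists_diffAt_eq_sum b hy G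
  have hPFG : (fun q => B q (diffAt J F q) (diffAt J G q)) =ᶠ[𝓝 p] fun q => ∑ k, ∑ l,
      c k q * d l q * B q (diffAt J (y k) q) (diffAt J (y l) q) := by
    filter_upwards [hcF, hdG] with q h1 h2
    simp only [h1, h2, map_sum, map_smul, LinearMap.sum_apply, LinearMap.smul_apply, smul_eq_mul,
      Finset.mul_sum, mul_assoc]
    exact Finset.sum_comm.trans (Finset.sum_congr rfl fun k _ => Finset.sum_congr rfl
      fun l _ => mul_left_comm _ _ _)
  have hX : ∀ (F : N → ℝ) (c : ι → N → ℝ), (∀ k, MDifferentiableAt J 𝓘(ℝ, ℝ) (c k) p) →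
      (∀ᶠ q in 𝓝 p, diffAt J F q = ∑ k, c k q • diffAt J (y k) q) →
      (∀ v w : TangentSpace J p, ∑ k, diffAt J (c k) p v * diffAt J (y k) p w =
        ∑ k, diffAt J (c k) p w * diffAt J (y k) p v) →
      diffAt J (derivAlong J X F) p = ∑ k, (c k p • diffAt J (derivAlong J X (y k)) p +
        diffAt J (c k) p (X p) • diffAt J (y k) p) := by
    intro F c hc hcF hcs
    have : derivAlong J X F =ᶠ[𝓝 p] fun q => ∑ k, c k q * derivAlong J X (y k) q := by
      filter_upwards [hcF] with q h
      simp only [derivAlong, h, sum_apply, smul_apply, smul_eq_mul]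
    have hm : ∀ k, MDifferentiableAt J 𝓘(ℝ, ℝ) (fun q => c k q * derivAlong J X (y k) q) p :=
      fun k => (hc k).mul (hXy k)
    rw [diffAt_congr this, diffAt_sum _ hm]
    ext w
    have hw := hcs (X p) w
    simp only [diffAt_mul (hc _) (hXy _), sum_apply, add_apply, smul_apply, smul_eq_mul,
      Finset.sum_add_distrib, hw]
    congr 1
    exact Finset.sum_congr rfl fun k _ => mul_comm _ _
  have hXP : derivAlong J X (fun q => B q (diffAt J F q) (diffAt J G q)) p = ∑ k, ∑ l,
      (c k p * d l p * derivAlong J X (fun q => B q (diffAt J (y k) q) (diffAt J (y l) q)) p +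
      B p (diffAt J (y k) p) (diffAt J (y l) p) *
        (c k p * diffAt J (d l) p (X p) + d l p * diffAt J (c k) p (X p))) := by
    have h1 : ∀ k l, MDifferentiableAt J 𝓘(ℝ, ℝ) (fun q => c k q * d l q) p :=
      fun k l => (hc k).mul (hd l)
    have h2 : ∀ k l, MDifferentiableAt J 𝓘(ℝ, ℝ)
        (fun q => c k q * d l q * B q (diffAt J (y k) q) (diffAt J (y l) q)) p :=
      fun k l => (h1 k l).mul (hPy k l)
    unfold derivAlong
    rw [diffAt_congr hPFG,
      diffAt_sum _ fun k => mdifferentiableAt_finset_sum _ (h2 k), sum_apply]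
    refine Finset.sum_congr rfl fun k _ => ?_
    rw [diffAt_sum _ (h2 k), sum_apply]
    refine Finset.sum_congr rfl fun l _ => ?_
    rw [diffAt_mul (h1 k l) (hPy k l), diffAt_mul (hc k) (hd l)]
    simp only [add_apply, smul_apply, smul_eq_mul]
  -- the terms with derivatives of `c` and `d` cancel
  have key : lieDerivBivector J X (fun q φ ψ => B q φ ψ) F G p = ∑ k, ∑ l, c k p * d l p *
      lieDerivBivector J X (fun q φ ψ => B q φ ψ) (y k) (y l) p := by
    unfold lieDerivBivector
    rw [hXP, hX F c hc hcF hcs, hX G d hd hdG hds, hcF.self_of_nhds, hdG.self_of_nhds]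
    simp only [map_sum, map_smul, map_add, LinearMap.sum_apply, LinearMap.smul_apply,
      LinearMap.add_apply, smul_eq_mul, Finset.mul_sum, ← Finset.sum_add_distrib]
    rw [Finset.sum_comm (f := fun l k => d l p * _), Finset.sum_comm (f := fun l k =>
      d l p * (c k p * _) + _), ← Finset.sum_sub_distrib, ← Finset.sum_sub_distrib]
    refine Finset.sum_congr rfl fun k _ => ?_
    rw [← Finset.sum_sub_distrib, ← Finset.sum_sub_distrib]
    refine Finset.sum_congr rfl fun l _ => ?_
    ring
  rw [key]
  simp [h0]

end Differentials

/-! ### The invariant formula for the exterior derivative of a 1-form -/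

section CartanFormula

/-- The trivialization of the dual bundle `V*` is the transpose of that of `V`. -/
theorem inCoordinates_trivial_apply {B F : Type*} [TopologicalSpace B] [NormedAddCommGroup F]
    [NormedSpace ℝ F] {V : B → Type*} [TopologicalSpace (Bundle.TotalSpace F V)]
    [∀ x, AddCommGroup (V x)] [∀ x, Module ℝ (V x)] [∀ x, TopologicalSpace (V x)]
    [FiberBundle F V] [VectorBundle ℝ F V] (x y : B) (θ : V y →L[ℝ] Bundle.Trivial B ℝ y) (w : F) :
    ContinuousLinearMap.inCoordinates F V ℝ (Bundle.Trivial B ℝ) x y x y θ w =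
      θ ((trivializationAt F V x).symmL ℝ y w) := by
  have h : ∀ r : ℝ, (trivializationAt ℝ (Bundle.Trivial B ℝ) x).continuousLinearMapAt ℝ y r = r :=
    fun r => DFunLike.congr_fun (Bundle.Trivial.continuousLinearMapAt_trivialization ℝ B ℝ y) r
  exact h _

theorem fderiv_clm_apply_sub_eq_of_lieBracket {E : Type*} [NormedAddCommGroup E] [NormedSpace ℝ E]
    {θ : E → E →L[ℝ] ℝ} {X Y : E → E} {z : E} (hθ : DifferentiableAt ℝ θ z)
    (hX : DifferentiableAt ℝ X z) (hY : DifferentiableAt ℝ Y z) :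
    fderiv ℝ θ z (X z) (Y z) - fderiv ℝ θ z (Y z) (X z) =
      fderiv ℝ (fun y => θ y (Y y)) z (X z) - fderiv ℝ (fun y => θ y (X y)) z (Y z)
        - θ z (VectorField.lieBracket ℝ X Y z) := by
  rw [fderiv_clm_apply hθ hX, fderiv_clm_apply hθ hY, VectorField.lieBracket]
  simp [ContinuousLinearMap.flip_apply]
  ring

variable {E : Type*} [NormedAddCommGroup E] [NormedSpace ℝ E] {H : Type*} [TopologicalSpace H]
  {I : ModelWithCorners ℝ E H} {M : Type*} [TopologicalSpace M] [ChartedSpace H M]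
  [IsManifold I ∞ M]

/-- The evaluation of a smooth 1-form on a smooth vector field is smooth. -/
theorem OneForm.contMDiffAt_apply (γ : OneForm I M) {X : (x : M) → TangentSpace I x} {x : M}
    (hX : ContMDiffAt I I.tangent ∞ (fun y => (⟨y, X y⟩ : TangentBundle I M)) x) :
    ContMDiffAt I 𝓘(ℝ, ℝ) ∞ (fun y => (γ y (X y) : ℝ)) x := by
  have h := (γ.contMDiff x).clm_bundle_apply (F₁ := E) (F₂ := ℝ)
    (E₁ := fun x : M => TangentSpace I x) (E₂ := Bundle.Trivial M ℝ) hX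
  exact (Bundle.contMDiffAt_totalSpace.1 h).2

variable [I.Boundaryless]

theorem OneForm.differentiableAt_inChart (γ : OneForm I M) (x : M) :
    DifferentiableAt ℝ (γ.inChart x) (extChartAt I x x) := by
  have h := ((contMDiffAt_hom_bundle _).1 (γ.contMDiff x)).2
  have h2 : ContMDiffAt 𝓘(ℝ, E) 𝓘(ℝ, E →L[ℝ] ℝ) ∞ ((fun y =>
      ContinuousLinearMap.inCoordinates E (TangentSpace I) ℝ (Bundle.Trivial M ℝ) x y x y (γ y)) ∘
        (extChartAt I x).symm) (extChartAt I x x) := by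
    refine ContMDiffAt.comp _ ?_ ((contMDiffOn_extChartAt_symm x).contMDiffAt
      ((isOpen_extChartAt_target x).mem_nhds (mem_extChartAt_target x)))
    rw [extChartAt_to_inv]
    exact h
  refine (h2.contDiffAt.differentiableAt (by simp)).congr_of_eventuallyEq ?_
  filter_upwards [(isOpen_extChartAt_target (I := I) x).mem_nhds (mem_extChartAt_target x)]
    with y hy
  have hy' : (extChartAt I x).symm y ∈ (chartAt H x).source := by
    simpa using (extChartAt I x).map_target hy
  have key := TangentBundle.symmL_trivializationAt (I := I) hy'
  rw [(extChartAt I x).right_inv hy, I.range_eq_univ, mfderivWithin_univ] at key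
  ext v
  exact ((inCoordinates_trivial_apply x _ _ v).trans
    (congrArg (fun w => (γ ((extChartAt I x).symm y) w : ℝ)) (DFunLike.congr_fun key v))).symm

/-- The invariant formula `dγ(X, Y) = X (γ Y) - Y (γ X) - γ [X, Y]`. -/
theorem OneForm.extDerivAt_apply_vectorField [CompleteSpace E] (γ : OneForm I M)
    {X Y : (x : M) → TangentSpace I x} {x : M}
    (hX : ContMDiffAt I I.tangent ∞ (fun y => (⟨y, X y⟩ : TangentBundle I M)) x)
    (hY : ContMDiffAt I I.tangent ∞ (fun y => (⟨y, Y y⟩ : TangentBundle I M)) x) :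
    γ.extDerivAt x (X x) (Y x) =
      diffAt I (fun y => (γ y (Y y) : ℝ)) x (X x) - diffAt I (fun y => (γ y (X y) : ℝ)) x (Y x)
        - (γ x (VectorField.mlieBracket I X Y x) : ℝ) := by
  have : IsManifold I 2 M := IsManifold.of_le (n := ∞) (by norm_cast)
  -- the coordinate expression of a vector field in the preferred chart at `x`
  have hrep : ∀ X : (x : M) → TangentSpace I x,
      ContMDiffAt I I.tangent ∞ (fun y => (⟨y, X y⟩ : TangentBundle I M)) x →
      ∃ Xt : E → E,
        Xt = VectorField.mpullbackWithin 𝓘(ℝ, E) I (extChartAt I x).symm X (Set.range I) ∧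
        DifferentiableAt ℝ Xt (extChartAt I x x) ∧ Xt (extChartAt I x x) = X x ∧
        ∀ v : TangentSpace I x, diffAt I (fun y => (γ y (X y) : ℝ)) x v =
          fderiv ℝ (fun z => γ.inChart x z (Xt z)) (extChartAt I x x) v := by
    intro X hX
    refine ⟨_, rfl, ?_, ?_, ?_⟩
    · have := ((hX.mdifferentiableAt (by simp)).mdifferentiableWithinAt
        (s := Set.univ)).differentiableWithinAt_mpullbackWithin_vectorField
      rw [Set.preimage_univ, Set.univ_inter] at this
      exact this.differentiableAt (by rw [I.range_eq_univ]; exact univ_mem)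
    · rw [VectorField.mpullbackWithin_apply, extChartAt_to_inv]
      exact mfderivWithin_extChartAt_symm_inverse_apply (X x)
    · intro v
      rw [diffAt_eq_fderiv ((γ.contMDiffAt_apply hX).mdifferentiableAt (by simp))]
      have hev : (fun y => (γ y (X y) : ℝ)) ∘ (extChartAt I x).symm =ᶠ[𝓝 (extChartAt I x x)]
          fun z => γ.inChart x z (VectorField.mpullbackWithin 𝓘(ℝ, E) I (extChartAt I x).symm X
            (Set.range I) z) := ?_
      · exact DFunLike.congr_fun hev.fderiv_eq v
      filter_upwards [(isOpen_extChartAt_target (I := I) x).mem_nhds (mem_extChartAt_target x)]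
        with y hy
      obtain ⟨e, he⟩ := isInvertible_mfderivWithin_extChartAt_symm (I := I) hy
      have h2 : (mfderiv 𝓘(ℝ, E) I (extChartAt I x).symm y) = e := by
        rw [← mfderivWithin_univ, ← I.range_eq_univ, he]
      have h3 : mfderiv 𝓘(ℝ, E) I (extChartAt I x).symm y
          (VectorField.mpullbackWithin 𝓘(ℝ, E) I (extChartAt I x).symm X (Set.range I) y) =
          X ((extChartAt I x).symm y) := by
        rw [VectorField.mpullbackWithin_apply, ← he, h2, ContinuousLinearMap.inverse_equiv]
        exact e.apply_symm_apply _
      exact congrArg (fun w => (γ ((extChartAt I x).symm y) w : ℝ)) h3.symm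
  obtain ⟨Xt, hXt, hXd, hXx, hXf⟩ := hrep X hX
  obtain ⟨Yt, hYt, hYd, hYx, hYf⟩ := hrep Y hY
  have hsymm : mfderiv 𝓘(ℝ, E) I (extChartAt I x).symm (extChartAt I x x) =
      ContinuousLinearMap.id ℝ E := by
    rw [← mfderivWithin_univ, ← I.range_eq_univ]
    exact mfderivWithin_range_extChartAt_symm
  have hbr : VectorField.mlieBracket I X Y x =
      VectorField.lieBracket ℝ Xt Yt (extChartAt I x x) := by
    rw [← VectorField.mlieBracketWithin_univ, VectorField.mlieBracketWithin_apply,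
      Set.preimage_univ, Set.univ_inter, mfderiv_extChartAt_self, ← hXt, ← hYt, I.range_eq_univ,
      VectorField.lieBracketWithin_univ]
    exact DFunLike.congr_fun (ContinuousLinearMap.inverse_id (R := ℝ) (M := E)) _
  have hγ : ∀ v : E, γ.inChart x (extChartAt I x x) v = γ x v := by
    intro v
    have h1 : γ.inChart x (extChartAt I x x) v = γ ((extChartAt I x).symm (extChartAt I x x))
      (mfderiv 𝓘(ℝ, E) I (extChartAt I x).symm (extChartAt I x x) v) := rfl
    rw [h1, hsymm]
    rw [extChartAt_to_inv]
    rfl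
  have := fderiv_clm_apply_sub_eq_of_lieBracket (γ.differentiableAt_inChart x) hXd hYd
  rw [hXf, hYf, hbr, ← hγ]
  rw [hXx, hYx] at this
  exact this

end CartanFormula

/-! ### Global sections and functions with prescribed germs -/

section SectionAlgebra

variable {E : Type*} [NormedAddCommGroup E] [NormedSpace ℝ E]
  {H : Type*} [TopologicalSpace H] {I : ModelWithCorners ℝ E H}
  {M : Type*} [TopologicalSpace M] [ChartedSpace H M]
  {F : Type*} [NormedAddCommGroup F] [NormedSpace ℝ F]
  {V : M → Type*} [TopologicalSpace (Bundle.TotalSpace F V)]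
  [∀ x, AddCommGroup (V x)] [∀ x, Module ℝ (V x)] [∀ x, TopologicalSpace (V x)]
  [FiberBundle F V] [VectorBundle ℝ F V]

/-- The product of a smooth function and a smooth section. -/
noncomputable def ContMDiffMap.smulSection (f : C^∞⟮I, M; ℝ⟯) (s : Cₛ^∞⟮I; F, V⟯) : Cₛ^∞⟮I; F, V⟯ :=
  ⟨fun y => f y • s y, f.contMDiff.smul_section s.contMDiff⟩

theorem ContMDiffSection.finset_sum_apply {ι : Type*} (t : Finset ι) (s : ι → Cₛ^∞⟮I; F, V⟯)
    (x : M) : (∑ i ∈ t, s i) x = ∑ i ∈ t, s i x := by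
  have h := map_sum (ContMDiffSection.coeAddHom I F ∞ V) s t
  exact (congrFun h x).trans (Finset.sum_apply x t fun i => ⇑(s i))

end SectionAlgebra

section SmoothExtension

variable {E : Type*} [NormedAddCommGroup E] [NormedSpace ℝ E] [FiniteDimensional ℝ E]
  {H : Type*} [TopologicalSpace H] (I : ModelWithCorners ℝ E H)
  {M : Type*} [TopologicalSpace M] [ChartedSpace H M] [IsManifold I ∞ M] [T2Space M]

/-- Every germ of a smooth function extends to a global smooth function. -/
theorem exists_contMDiffMap_eventuallyEq {g : M → ℝ} {s : Set M} {x : M} (hs : IsOpen s)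
    (hx : x ∈ s) (hg : ContMDiffOn I 𝓘(ℝ, ℝ) ∞ g s) : ∃ f : C^∞⟮I, M; ℝ⟯, ⇑f =ᶠ[𝓝 x] g := by
  obtain ⟨χ, -, hχ⟩ := (SmoothBumpFunction.nhds_basis_tsupport (I := I) x).mem_iff.1
    (hs.mem_nhds hx)
  refine ⟨⟨fun y => χ y * g y, contMDiff_of_tsupport fun y hy => ?_⟩, ?_⟩
  · exact χ.contMDiffAt.mul (hg.contMDiffAt (hs.mem_nhds (hχ (tsupport_mul_subset_left hy))))
  · filter_upwards [χ.eventuallyEq_one] with y hy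
    simp [hy]

variable (F : Type*) [NormedAddCommGroup F] [NormedSpace ℝ F]
  (V : M → Type*) [TopologicalSpace (Bundle.TotalSpace F V)]
  [∀ x, AddCommGroup (V x)] [∀ x, Module ℝ (V x)] [∀ x, TopologicalSpace (V x)]
  [FiberBundle F V]

variable {F V} in
/-- A cutoff function at a point near which a section vanishes, whose product with that section
vanishes everywhere. -/
theorem exists_bump_smul_eq_zero {w : Cₛ^∞⟮I; F, V⟯} {x : M} (hw : ∀ᶠ y in 𝓝 x, w y = 0) :
    ∃ χ : C^∞⟮I, M; ℝ⟯, χ x = 1 ∧ ∀ y, χ y • w y = 0 := by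
  obtain ⟨χ, -, hχ⟩ := (SmoothBumpFunction.nhds_basis_tsupport (I := I) x).mem_iff.1 hw
  refine ⟨⟨χ, χ.contMDiff⟩, χ.eq_one, fun y => ?_⟩
  by_cases hy : y ∈ tsupport χ
  · rw [hχ hy, smul_zero]
  · simp [image_eq_zero_of_notMem_tsupport hy]

variable [VectorBundle ℝ F V] [ContMDiffVectorBundle ∞ F V I]

/-- A global smooth section that is constant near `x` in the preferred trivialization. -/
theorem exists_section_eventuallyEq_symmL (x : M) (w : F) :
    ∃ s : Cₛ^∞⟮I; F, V⟯, ∀ᶠ y in 𝓝 x, s y = (trivializationAt F V x).symmL ℝ y w := by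
  set t := trivializationAt F V x
  have ht : t.baseSet ∈ 𝓝 x := t.open_baseSet.mem_nhds (FiberBundle.mem_baseSet_trivializationAt' x)
  obtain ⟨χ, -, hχ⟩ := (SmoothBumpFunction.nhds_basis_tsupport (I := I) x).mem_iff.1 ht
  have hw : ContMDiffOn I (I.prod 𝓘(ℝ, F)) ∞
      (fun y => (⟨y, t.symmL ℝ y w⟩ : Bundle.TotalSpace F V)) t.baseSet := by
    intro y hy
    rw [t.contMDiffWithinAt_section _ hy]
    refine (contMDiffWithinAt_const (c := w)).congr (fun z hz => ?_) ?_
    · rw [Bundle.Trivialization.symmL_apply _ hz, t.apply_mk_symm hz]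
    · rw [Bundle.Trivialization.symmL_apply _ hy, t.apply_mk_symm hy]
  refine ⟨⟨(χ : M → ℝ) • fun y => t.symmL ℝ y w,
    ContMDiffOn.smul_section_of_tsupport χ.contMDiff.contMDiffOn t.open_baseSet hχ hw⟩, ?_⟩
  filter_upwards [χ.eventuallyEq_one] with y hy
  simp [hy, t]

variable {F V}

theorem exists_section_apply_eq (x : M) (a : V x) : ∃ s : Cₛ^∞⟮I; F, V⟯, s x = a := by
  obtain ⟨s, hs⟩ := exists_section_eventuallyEq_symmL I F V x
    ((trivializationAt F V x).continuousLinearMapAt ℝ x a)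
  exact ⟨s, hs.self_of_nhds.trans (Bundle.Trivialization.symmL_continuousLinearMapAt _
    (FiberBundle.mem_baseSet_trivializationAt' x) a)⟩

/-- A smooth section is, near `x`, a combination of a local frame with smooth coefficients; frame
and coefficients are restrictions of global objects. -/
theorem exists_section_eventuallyEq_sum {ι : Type*} [Fintype ι]
    (b : Basis ι ℝ F) (x : M) (u : Cₛ^∞⟮I; F, V⟯) :
    ∃ (s : ι → Cₛ^∞⟮I; F, V⟯) (c : ι → C^∞⟮I, M; ℝ⟯),
      (∀ i, ∀ᶠ y in 𝓝 x, s i y = (trivializationAt F V x).symmL ℝ y (b i)) ∧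
      (∀ᶠ y in 𝓝 x, (trivializationAt F V x).continuousLinearMapAt ℝ y (u y) =
        ∑ i, c i y • b i) ∧
      ∀ᶠ y in 𝓝 x, u y = ∑ i, c i y • s i y := by
  set t := trivializationAt F V x with ht
  have hmem : t.baseSet ∈ 𝓝 x :=
    t.open_baseSet.mem_nhds (FiberBundle.mem_baseSet_trivializationAt' x)
  choose s hs using fun i => exists_section_eventuallyEq_symmL I F V x (b i)
  have hu : ContMDiffOn I 𝓘(ℝ, F) ∞ (fun y => (t ⟨y, u y⟩).2) t.baseSet := fun y hy =>
    (t.contMDiffWithinAt_section _ hy).1 (u.contMDiff y).contMDiffWithinAt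
  have hc : ∀ i, ∃ c : C^∞⟮I, M; ℝ⟯, ⇑c =ᶠ[𝓝 x] fun y => b.equivFunL (t ⟨y, u y⟩).2 i := by
    intro i
    refine exists_contMDiffMap_eventuallyEq I t.open_baseSet
      (FiberBundle.mem_baseSet_trivializationAt' x) ?_
    let L : F →L[ℝ] ℝ := (ContinuousLinearMap.proj i).comp b.equivFunL.toContinuousLinearMap
    exact L.contMDiff.comp_contMDiffOn hu
  choose c hc using hc
  have hsum : ∀ᶠ y in 𝓝 x, t.continuousLinearMapAt ℝ y (u y) = ∑ i, c i y • b i := by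
    filter_upwards [hmem, eventually_all.2 hc] with y hy h
    rw [Bundle.Trivialization.continuousLinearMapAt_apply,
      Bundle.Trivialization.coe_linearMapAt_of_mem _ hy]
    simp only [h]
    exact (b.sum_equivFun _).symm
  refine ⟨s, c, hs, hsum, ?_⟩
  filter_upwards [hmem, eventually_all.2 hs, hsum] with y hy h1 h2
  rw [← t.symmL_continuousLinearMapAt (R := ℝ) hy (u y), h2, map_sum]
  simp [h1, ← ht]

end SmoothExtension

/-! ### Affine functions on the dual bundle -/

section AffineFunctions

variable {E : Type*} [NormedAddCommGroup E] [NormedSpace ℝ E]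
  {H : Type*} [TopologicalSpace H] {I : ModelWithCorners ℝ E H}
  {M : Type*} [TopologicalSpace M] [ChartedSpace H M]
  {F : Type*} [NormedAddCommGroup F] [NormedSpace ℝ F]
  {V : M → Type*} [TopologicalSpace (Bundle.TotalSpace F V)]
  [∀ x, AddCommGroup (V x)] [∀ x, Module ℝ (V x)] [∀ x, TopologicalSpace (V x)]
  [FiberBundle F V] [VectorBundle ℝ F V]

/-- The fibrewise affine function `l_u + p*f` on the dual bundle. -/
noncomputable def affineFun (a : Cₛ^∞⟮I; F, V⟯ × C^∞⟮I, M; ℝ⟯) (β : DualTotal F V) : ℝ :=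
  linearFun a.1 β + a.2 β.1

theorem affineFun_add (a b : Cₛ^∞⟮I; F, V⟯ × C^∞⟮I, M; ℝ⟯) :
    affineFun (a + b) = fun β => affineFun a β + affineFun b β := by
  funext β
  simp only [affineFun, linearFun, Prod.fst_add, Prod.snd_add, ContMDiffSection.coe_add,
    ContMDiffMap.coe_add, Pi.add_apply, map_add]
  ring

theorem affineFun_smul (c : ℝ) (a : Cₛ^∞⟮I; F, V⟯ × C^∞⟮I, M; ℝ⟯) :
    affineFun (c • a) = fun β => c * affineFun a β := by
  funext β
  simp only [affineFun, linearFun, Prod.smul_fst, Prod.smul_snd, ContMDiffSection.coe_smul,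
    ContMDiffMap.coe_smul, Pi.smul_apply, map_smul, smul_eq_mul]
  ring

theorem contMDiff_linearFun (u : Cₛ^∞⟮I; F, V⟯) :
    ContMDiff (dualModel I F) 𝓘(ℝ, ℝ) ∞ (linearFun u : DualTotal F V → ℝ) := by
  -- `l_u` is the pairing of the tautological section of the pullback of `V*` with that of `u`
  intro α
  have hp : ContMDiff (dualModel I F) I ∞ (fun β : DualTotal F V => β.1) :=
    Bundle.contMDiff_proj _
  have h := ContMDiffAt.clm_bundle_apply (n := ∞) (F₁ := F) (F₂ := ℝ) (E₁ := V)
    (E₂ := Bundle.Trivial M ℝ) (IM := dualModel I F) (IB := I)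
    (b := fun β : DualTotal F V => β.1) (ϕ := fun β => β.2) (v := fun β => u β.1) (x := α)
    contMDiffAt_id (u.contMDiff.contMDiffAt.comp α hp.contMDiffAt)
  exact (Bundle.contMDiffAt_totalSpace.1 h).2

theorem contMDiff_affineFun (a : Cₛ^∞⟮I; F, V⟯ × C^∞⟮I, M; ℝ⟯) :
    ContMDiff (dualModel I F) 𝓘(ℝ, ℝ) ∞ (affineFun a : DualTotal F V → ℝ) :=
  (contMDiff_linearFun a.1).add (a.2.contMDiff.comp (Bundle.contMDiff_proj _))

theorem mdifferentiableAt_affineFun (a : Cₛ^∞⟮I; F, V⟯ × C^∞⟮I, M; ℝ⟯) (α : DualTotal F V) :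
    MDifferentiableAt (dualModel I F) 𝓘(ℝ, ℝ) (affineFun a) α :=
  (contMDiff_affineFun a).mdifferentiableAt (by simp)

/-- The differential at `α` of affine functions, as a linear map. -/
noncomputable def affineDiff (α : DualTotal F V) :
    (Cₛ^∞⟮I; F, V⟯ × C^∞⟮I, M; ℝ⟯) →ₗ[ℝ] Cotangent (dualModel I F) α where
  toFun a := diffAt (dualModel I F) (affineFun a) α
  map_add' a b := by
    rw [affineFun_add,
      diffAt_add (mdifferentiableAt_affineFun a α) (mdifferentiableAt_affineFun b α)]
  map_smul' c a := by
    rw [affineFun_smul, diffAt_const_mul c (mdifferentiableAt_affineFun a α)]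
    rfl

theorem mdifferentiableAt_verticalLine (x : M) (ξ β : V x →L[ℝ] ℝ) :
    MDifferentiableAt 𝓘(ℝ, ℝ) (dualModel I F)
      (fun t : ℝ => (⟨x, ξ - t • β⟩ : DualTotal F V)) 0 := by
  have h : ContMDiffAt 𝓘(ℝ, ℝ) (dualModel I F) ∞
      (fun t : ℝ => (⟨x, ξ - t • β⟩ : DualTotal F V)) 0 := by
    rw [Bundle.contMDiffAt_totalSpace]
    refine ⟨contMDiffAt_const, ?_⟩
    set L := (trivializationAt (F →L[ℝ] ℝ) (fun x : M => V x →L[ℝ] Bundle.Trivial M ℝ x)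
      x).continuousLinearMapAt ℝ x with hL
    have hL' : ∀ θ : V x →L[ℝ] ℝ, (trivializationAt (F →L[ℝ] ℝ)
        (fun x : M => V x →L[ℝ] Bundle.Trivial M ℝ x) x ⟨x, θ⟩).2 = L θ := by
      intro θ
      rw [hL, Bundle.Trivialization.continuousLinearMapAt_apply,
        Bundle.Trivialization.coe_linearMapAt_of_mem _
          (FiberBundle.mem_baseSet_trivializationAt' x)]
    simp only [hL']
    have : ∀ t : ℝ, L (ξ - t • β) = L ξ - t • L β := fun t => by
      rw [← map_smul]
      exact map_sub L _ _
    simp only [this]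
    exact (contDiff_const.sub (contDiff_id.smul contDiff_const)).contMDiff.contMDiffAt
  exact h.mdifferentiableAt (by simp)

/-- The derivative of `l_u + p*f` along a vertical line in direction `-β`. -/
theorem diffAt_affineFun_verticalLine (a : Cₛ^∞⟮I; F, V⟯ × C^∞⟮I, M; ℝ⟯) (α : DualTotal F V)
    (β : V α.1 →L[ℝ] ℝ) :
    diffAt (dualModel I F) (affineFun a) α (mfderiv 𝓘(ℝ, ℝ) (dualModel I F)
      (fun t : ℝ => (⟨α.1, α.2 - t • β⟩ : DualTotal F V)) 0 (1 : ℝ)) = -β (a.1 α.1) := by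
  have h0 : (⟨α.1, α.2 - (0 : ℝ) • β⟩ : DualTotal F V) = α := by
    rw [zero_smul]
    exact congrArg _ (sub_zero α.2)
  -- `α - 0 • β` is only propositionally equal to `α`, so that the base point has to be moved
  have hpt : ∀ (p q : DualTotal F V), p = q → ∀ v : E × (F →L[ℝ] ℝ),
      diffAt (dualModel I F) (affineFun a) p v = diffAt (dualModel I F) (affineFun a) q v := by
    rintro p _ rfl v
    rfl
  have h1 := diffAt_comp_apply (K := 𝓘(ℝ, ℝ)) (x := (0 : ℝ))
    (mdifferentiableAt_affineFun a _) (mdifferentiableAt_verticalLine (I := I) (F := F) α.1 α.2 β)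
    (1 : ℝ)
  have h2 : ∀ t : ℝ, affineFun a (⟨α.1, α.2 - t • β⟩ : DualTotal F V) =
      affineFun a α - t * β (a.1 α.1) := by
    intro t
    have : (α.2 - t • β) (a.1 α.1) = α.2 (a.1 α.1) - t * β (a.1 α.1) := rfl
    simp only [affineFun, linearFun, this]
    ring
  have h3 : diffAt 𝓘(ℝ, ℝ) (fun t : ℝ => affineFun a (⟨α.1, α.2 - t • β⟩ : DualTotal F V)) 0
      (1 : ℝ) = -β (a.1 α.1) := by
    simp only [h2]
    have : HasDerivAt (fun t : ℝ => affineFun a α - t * β (a.1 α.1)) (-β (a.1 α.1)) 0 := by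
      simpa using ((hasDerivAt_id (0 : ℝ)).mul_const (β (a.1 α.1))).const_sub (affineFun a α)
    rw [diffAt, mfderiv_eq_fderiv]
    exact this.deriv
  rw [← h3, h1]
  exact (hpt _ _ h0 _).symm

end AffineFunctions

/-! ### Locality of the bracket and critical points of affine functions -/

section LinearPoisson

variable {E : Type*} [NormedAddCommGroup E] [NormedSpace ℝ E]
  {H : Type*} [TopologicalSpace H] {I : ModelWithCorners ℝ E H}
  {M : Type*} [TopologicalSpace M] [ChartedSpace H M] [IsManifold I ∞ M]
  {F : Type*} [NormedAddCommGroup F] [NormedSpace ℝ F]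
  {V : M → Type*} [TopologicalSpace (Bundle.TotalSpace F V)]
  [∀ x, AddCommGroup (V x)] [∀ x, Module ℝ (V x)] [∀ x, TopologicalSpace (V x)]
  [FiberBundle F V] [VectorBundle ℝ F V]

theorem hom_continuousLinearMapAt_apply {x y : M}
    (hy : y ∈ (trivializationAt F V x).baseSet) (θ : V y →L[ℝ] ℝ) (w : F) :
    (trivializationAt (F →L[ℝ] ℝ) (fun x : M => V x →L[ℝ] Bundle.Trivial M ℝ x)
      x).continuousLinearMapAt ℝ y θ w = θ ((trivializationAt F V x).symmL ℝ y w) := by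
  rw [Bundle.Trivialization.continuousLinearMapAt_apply,
    Bundle.Trivialization.coe_linearMapAt_of_mem _
      (by rw [hom_trivializationAt_baseSet]; exact ⟨hy, trivial⟩)]
  exact inCoordinates_trivial_apply x y θ w

theorem LieAlgebroid.bracket_skew (A : LieAlgebroid I F V) (u v : Cₛ^∞⟮I; F, V⟯) :
    A.bracket u v = -A.bracket v u := by
  have h := A.bracket_self (u + v)
  simp only [map_add, LinearMap.add_apply, A.bracket_self, zero_add, add_zero] at h
  exact eq_neg_of_add_eq_zero_right h

variable [FiniteDimensional ℝ E] [T2Space M]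

/-- The bracket is local: it vanishes at `x` if its second argument vanishes near `x`. -/
theorem LieAlgebroid.bracket_apply_eq_zero_of_eventually (A : LieAlgebroid I F V)
    (v : Cₛ^∞⟮I; F, V⟯) {w : Cₛ^∞⟮I; F, V⟯} {x : M}
    (hw : ∀ᶠ y in 𝓝 x, w y = 0) : A.bracket v w x = 0 := by
  obtain ⟨χ, hχ, hχw⟩ := exists_bump_smul_eq_zero I hw
  -- `0 = [v, χ w] = χ [v, w] + (ρ(v) χ) w` at `x`
  have h := A.leibniz v w 0 χ (fun y => (hχw y).symm) x
  rw [map_zero, hχ, hw.self_of_nhds] at h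
  simpa using h.symm

variable [ContMDiffVectorBundle ∞ F V I]

/-- A smooth section of the dual bundle through `α` that is constant near the base point in the
preferred trivialization. -/
theorem exists_dual_section (α : DualTotal F V) :
    ∃ s : Cₛ^∞⟮I; F →L[ℝ] ℝ, fun x : M => V x →L[ℝ] Bundle.Trivial M ℝ x⟯, s α.1 = α.2 ∧
      ∀ᶠ y in 𝓝 α.1, ∀ a : V y, s y a = α.2 ((trivializationAt F V α.1).symmL ℝ α.1
        ((trivializationAt F V α.1).continuousLinearMapAt ℝ y a)) := by
  set t := trivializationAt F V α.1 with ht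
  set t' := trivializationAt (F →L[ℝ] ℝ) (fun x : M => V x →L[ℝ] Bundle.Trivial M ℝ x) α.1 with ht'
  have hx : α.1 ∈ t.baseSet := FiberBundle.mem_baseSet_trivializationAt' α.1
  have hx' : α.1 ∈ t'.baseSet := FiberBundle.mem_baseSet_trivializationAt' α.1
  obtain ⟨s, hs⟩ := exists_section_eventuallyEq_symmL I (F →L[ℝ] ℝ)
    (fun x : M => V x →L[ℝ] Bundle.Trivial M ℝ x) α.1 (t'.continuousLinearMapAt ℝ α.1 α.2)
  refine ⟨s, hs.self_of_nhds.trans (t'.symmL_continuousLinearMapAt (R := ℝ) hx' _), ?_⟩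
  filter_upwards [hs, t.open_baseSet.mem_nhds hx, t'.open_baseSet.mem_nhds hx'] with y h hy hy' a
  have h1 : t'.continuousLinearMapAt ℝ y (s y) = t'.continuousLinearMapAt ℝ α.1 α.2 := by
    rw [h]
    exact t'.continuousLinearMapAt_symmL (R := ℝ) hy' _
  have h2 := hom_continuousLinearMapAt_apply hy (s y) (t.continuousLinearMapAt ℝ y a)
  have h3 := hom_continuousLinearMapAt_apply hx α.2 (t.continuousLinearMapAt ℝ y a)
  have h4 : t.symmL ℝ y (t.continuousLinearMapAt ℝ y a) = a :=
    t.symmL_continuousLinearMapAt (R := ℝ) hy a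
  exact (congrArg (fun z => (s y z : ℝ)) h4).symm.trans
    (h2.symm.trans ((DFunLike.congr_fun h1 _).trans h3))

namespace LieAlgebroid

variable (A : LieAlgebroid I F V)

variable [FiniteDimensional ℝ F]

/-- If `l_u + p*f` is critical at `α`, then `u` vanishes at the base point, and the first-order
part of `u` there is tied to `df`. This is what makes the Lie-Poisson bivector well defined. -/
theorem linearFun_bracket_add_eq_zero {α : DualTotal F V} {u : Cₛ^∞⟮I; F, V⟯}
    {f : C^∞⟮I, M; ℝ⟯} (h : diffAt (dualModel I F) (affineFun (u, f)) α = 0)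
    (v : Cₛ^∞⟮I; F, V⟯) :
    u α.1 = 0 ∧ linearFun (A.bracket v u) α + diffAt I f α.1 (A.anchor α.1 (v α.1)) = 0 := by
  set t := trivializationAt F V α.1 with ht
  have hx : α.1 ∈ t.baseSet := FiberBundle.mem_baseSet_trivializationAt' α.1
  -- criticality along the fibre
  have hu : u α.1 = 0 := by
    have hξ : ∀ ξ : F →L[ℝ] ℝ, ξ (t.continuousLinearMapAt ℝ α.1 (u α.1)) = 0 := by
      intro ξ
      have := diffAt_affineFun_verticalLine (I := I) (u, f) α
        (ξ.comp (t.continuousLinearMapAt ℝ α.1))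
      rw [h] at this
      exact neg_eq_zero.1 this.symm
    have h0 : t.continuousLinearMapAt ℝ α.1 (u α.1) = 0 := by
      refine (forall_dual_apply_eq_zero_iff ℝ _).1 fun ξ => ?_
      exact hξ (LinearMap.toContinuousLinearMap ξ)
    rw [← t.symmL_continuousLinearMapAt (R := ℝ) hx (u α.1), h0, map_zero]
  refine ⟨hu, ?_⟩
  let b := finBasis ℝ F
  obtain ⟨s, c, hs, hcu, hu'⟩ := exists_section_eventuallyEq_sum I b α.1 u
  have hc0 : ∀ i, c i α.1 = 0 := by
    have h0 := hcu.self_of_nhds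
    rw [hu, map_zero] at h0
    exact fun i => linearIndependent_iff'.1 b.linearIndependent _ _ h0.symm i (Finset.mem_univ i)
  -- the bracket at `α.1`, by locality and the Leibniz rule
  have hbr : A.bracket v u α.1 = ∑ i, diffAt I (c i) α.1 (A.anchor α.1 (v α.1)) • s i α.1 := by
    have h1 : A.bracket v (u - ∑ i, (c i).smulSection (s i)) α.1 = 0 := by
      refine A.bracket_apply_eq_zero_of_eventually v ?_
      filter_upwards [hu'] with y hy
      rw [ContMDiffSection.coe_sub, Pi.sub_apply, ContMDiffSection.finset_sum_apply, hy]
      exact sub_self _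
    rw [map_sub, map_sum, ContMDiffSection.coe_sub, Pi.sub_apply,
      ContMDiffSection.finset_sum_apply, sub_eq_zero] at h1
    rw [h1]
    refine Finset.sum_congr rfl fun i _ => ?_
    rw [A.leibniz v (s i) ((c i).smulSection (s i)) (c i) (fun _ => rfl), hc0, zero_smul, zero_add]
  -- the restriction of `l_u + p*f` to a section through `α` that is constant in the frame
  obtain ⟨σ, hσx, hσ⟩ := exists_dual_section (I := I) α
  have hα : (⟨α.1, σ α.1⟩ : DualTotal F V) = α := by rw [hσx]
  have hσf : (fun y => affineFun (u, f) (⟨y, σ y⟩ : DualTotal F V)) =ᶠ[𝓝 α.1]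
      fun y => (∑ i, α.2 (s i α.1) * c i y) + f y := by
    filter_upwards [hσ, hcu] with y h1 h2
    simp only [affineFun, linearFun]
    rw [h1, h2]
    simp only [map_sum, map_smul, fun i => (hs i).self_of_nhds, smul_eq_mul, mul_comm]
  have hcd : ∀ f : C^∞⟮I, M; ℝ⟯, MDifferentiableAt I 𝓘(ℝ, ℝ) f α.1 :=
    fun f => f.contMDiff.mdifferentiableAt (by simp)
  have hd : diffAt I (fun y => affineFun (u, f) (⟨y, σ y⟩ : DualTotal F V)) α.1 = 0 := by
    have hcrit : ∀ β : DualTotal F V, β = α → diffAt (dualModel I F) (affineFun (u, f)) β = 0 := by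
      rintro _ rfl
      exact h
    ext w
    rw [diffAt_comp_apply (mdifferentiableAt_affineFun (u, f) _)
      (σ.contMDiff.mdifferentiableAt (by simp)) w, hcrit _ hα]
    rfl
  have hm : ∀ i, MDifferentiableAt I 𝓘(ℝ, ℝ) (fun y => α.2 (s i α.1) * c i y) α.1 :=
    fun i => mdifferentiableAt_const.mul (hcd (c i))
  rw [diffAt_congr hσf, diffAt_add (mdifferentiableAt_finset_sum _ hm) (hcd f),
    diffAt_sum _ hm] at hd
  have := DFunLike.congr_fun hd (A.anchor α.1 (v α.1))
  simp only [diffAt_const_mul _ (hcd _), add_apply, sum_apply, smul_apply, smul_eq_mul] at this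
  rw [linearFun, hbr, map_sum]
  simp only [map_smul, smul_eq_mul]
  refine Eq.trans ?_ this
  simp only [mul_comm]

end LieAlgebroid

end LinearPoisson

/-! ### The Lie-Poisson bivector on affine functions -/

section AffineBracket

variable {E : Type*} [NormedAddCommGroup E] [NormedSpace ℝ E]
  {H : Type*} [TopologicalSpace H] {I : ModelWithCorners ℝ E H}
  {M : Type*} [TopologicalSpace M] [ChartedSpace H M] [IsManifold I ∞ M]
  {F : Type*} [NormedAddCommGroup F] [NormedSpace ℝ F]
  {V : M → Type*} [TopologicalSpace (Bundle.TotalSpace F V)]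
  [∀ x, AddCommGroup (V x)] [∀ x, Module ℝ (V x)] [∀ x, TopologicalSpace (V x)]
  [FiberBundle F V] [VectorBundle ℝ F V]

namespace LieAlgebroid

variable (A : LieAlgebroid I F V)

/-- The Poisson bracket `{l_u + p*f, l_v + p*g} = l_[u,v] + p*(ρ(u) g) - p*(ρ(v) f)` at `α`. -/
noncomputable def affineBracket (α : DualTotal F V) : (Cₛ^∞⟮I; F, V⟯ × C^∞⟮I, M; ℝ⟯) →ₗ[ℝ]
    (Cₛ^∞⟮I; F, V⟯ × C^∞⟮I, M; ℝ⟯) →ₗ[ℝ] ℝ :=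
  have hd (f : C^∞⟮I, M; ℝ⟯) : MDifferentiableAt I 𝓘(ℝ, ℝ) f α.1 :=
    f.contMDiff.mdifferentiableAt (by simp)
  LinearMap.mk₂ ℝ (fun a b => linearFun (A.bracket a.1 b.1) α
    + diffAt I b.2 α.1 (A.anchor α.1 (a.1 α.1)) - diffAt I a.2 α.1 (A.anchor α.1 (b.1 α.1)))
    (fun a a' b => by
      simp only [linearFun, Prod.fst_add, Prod.snd_add, map_add, LinearMap.add_apply,
        ContMDiffSection.coe_add, ContMDiffMap.coe_add, Pi.add_apply]
      rw [show ⇑a.2 + ⇑a'.2 = fun y => a.2 y + a'.2 y from rfl, diffAt_add (hd _) (hd _), add_apply]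
      ring)
    (fun c a b => by
      simp only [linearFun, Prod.smul_fst, Prod.smul_snd, map_smul, LinearMap.smul_apply,
        ContMDiffSection.coe_smul, ContMDiffMap.coe_smul, Pi.smul_apply, smul_eq_mul]
      rw [show c • ⇑a.2 = fun y => c * a.2 y from rfl, diffAt_const_mul c (hd _), smul_apply,
        smul_eq_mul]
      ring)
    (fun a b b' => by
      simp only [linearFun, Prod.fst_add, Prod.snd_add, map_add,
        ContMDiffSection.coe_add, ContMDiffMap.coe_add, Pi.add_apply]
      rw [show ⇑b.2 + ⇑b'.2 = fun y => b.2 y + b'.2 y from rfl, diffAt_add (hd _) (hd _), add_apply]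
      ring)
    (fun c a b => by
      simp only [linearFun, Prod.smul_fst, Prod.smul_snd, map_smul,
        ContMDiffSection.coe_smul, ContMDiffMap.coe_smul, Pi.smul_apply, smul_eq_mul]
      rw [show c • ⇑b.2 = fun y => c * b.2 y from rfl, diffAt_const_mul c (hd _), smul_apply,
        smul_eq_mul]
      ring)

theorem affineBracket_apply (α : DualTotal F V) (a b : Cₛ^∞⟮I; F, V⟯ × C^∞⟮I, M; ℝ⟯) :
    A.affineBracket α a b = linearFun (A.bracket a.1 b.1) α
      + diffAt I b.2 α.1 (A.anchor α.1 (a.1 α.1)) - diffAt I a.2 α.1 (A.anchor α.1 (b.1 α.1)) :=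
  rfl

theorem affineBracket_skew (α : DualTotal F V) (a b : Cₛ^∞⟮I; F, V⟯ × C^∞⟮I, M; ℝ⟯) :
    A.affineBracket α a b = -A.affineBracket α b a := by
  rw [affineBracket_apply, affineBracket_apply, A.bracket_skew]
  simp only [linearFun, ContMDiffSection.coe_neg, Pi.neg_apply, map_neg]
  ring

end LieAlgebroid

end AffineBracket

section LiePoisson

variable {E : Type*} [NormedAddCommGroup E] [NormedSpace ℝ E] [FiniteDimensional ℝ E]
  {H : Type*} [TopologicalSpace H] {I : ModelWithCorners ℝ E H}
  {M : Type*} [TopologicalSpace M] [ChartedSpace H M] [IsManifold I ∞ M] [T2Space M]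
  {F : Type*} [NormedAddCommGroup F] [NormedSpace ℝ F] [FiniteDimensional ℝ F]
  {V : M → Type*} [TopologicalSpace (Bundle.TotalSpace F V)]
  [∀ x, AddCommGroup (V x)] [∀ x, Module ℝ (V x)] [∀ x, TopologicalSpace (V x)]
  [FiberBundle F V] [VectorBundle ℝ F V] [ContMDiffVectorBundle ∞ F V I]

/-- Every linear function of the preferred chart of the dual bundle at `α` is, near `α`, of the
form `l_u + p*f`. -/
theorem exists_affineFun_eventuallyEq (α : DualTotal F V) (L : E × (F →L[ℝ] ℝ) →L[ℝ] ℝ) :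
    ∃ a : Cₛ^∞⟮I; F, V⟯ × C^∞⟮I, M; ℝ⟯, ∀ᶠ β in 𝓝 α,
      affineFun a β = L (extChartAt (dualModel I F) α β) := by
  -- the restriction of `L` to the fibre is evaluation at a vector `w`
  obtain ⟨w, hw⟩ : ∃ w : F, ∀ ξ : F →L[ℝ] ℝ, L (0, ξ) = ξ w := by
    let Lf : Dual ℝ (Dual ℝ F) := (L.toLinearMap ∘ₗ LinearMap.inr ℝ E (F →L[ℝ] ℝ)) ∘ₗ
      (LinearMap.toContinuousLinearMap : (F →ₗ[ℝ] ℝ) ≃ₗ[ℝ] F →L[ℝ] ℝ).toLinearMap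
    obtain ⟨w, hw⟩ := (evalEquiv ℝ F).surjective Lf
    refine ⟨w, fun ξ => ?_⟩
    have := LinearMap.congr_fun hw (ξ : F →ₗ[ℝ] ℝ)
    exact this.symm
  obtain ⟨s, hs⟩ := exists_section_eventuallyEq_symmL I F V α.1 w
  obtain ⟨f, hf⟩ := exists_contMDiffMap_eventuallyEq I (x := α.1)
    (g := fun y => L (extChartAt I α.1 y, 0)) (isOpen_extChartAt_source (I := I) α.1)
    (mem_extChartAt_source α.1) (by
      have h : ContMDiffOn I 𝓘(ℝ, E) ∞ (extChartAt I α.1) (extChartAt I α.1).source := by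
        simpa using contMDiffOn_extChartAt
      exact ((L.comp (ContinuousLinearMap.inl ℝ E (F →L[ℝ] ℝ))).contMDiff).comp_contMDiffOn h)
  refine ⟨(s, f), ?_⟩
  have hp : Tendsto (fun β : DualTotal F V => β.1) (𝓝 α) (𝓝 α.1) :=
    (FiberBundle.continuous_proj (F →L[ℝ] ℝ) _).tendsto α
  filter_upwards [hp.eventually hs, hp.eventually hf] with β h1 h2
  have h3 : extChartAt (dualModel I F) α β = (extChartAt I α.1 β.1,
      ContinuousLinearMap.inCoordinates F V ℝ (Bundle.Trivial M ℝ) α.1 β.1 α.1 β.1 β.2) := by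
    rw [FiberBundle.extChartAt]
    rfl
  have h4 : ∀ (z : E) (ξ : F →L[ℝ] ℝ), L (z, ξ) = L (z, 0) + ξ w := fun z ξ => by
    rw [← hw, ← map_add]
    simp
  rw [h3, h4, inCoordinates_trivial_apply, ← h1, ← h2]
  exact add_comm _ _

namespace LieAlgebroid

variable (A : LieAlgebroid I F V)

theorem affineBracket_eq_zero {α : DualTotal F V} {a : Cₛ^∞⟮I; F, V⟯ × C^∞⟮I, M; ℝ⟯}
    (ha : affineDiff α a = 0) (b : Cₛ^∞⟮I; F, V⟯ × C^∞⟮I, M; ℝ⟯) :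
    A.affineBracket α b a = 0 := by
  obtain ⟨h1, h2⟩ := A.linearFun_bracket_add_eq_zero (u := a.1) (f := a.2) ha b.1
  rw [affineBracket_apply, h1, map_zero, map_zero, sub_zero, h2]

/-- The value of the Lie-Poisson bivector does not depend on the choice of functions `l_u + p*f`
representing the two covectors. -/
theorem liePoisson_affineDiff (α : DualTotal F V) (a b : Cₛ^∞⟮I; F, V⟯ × C^∞⟮I, M; ℝ⟯) :
    A.liePoisson α (affineDiff α a) (affineDiff α b) = A.affineBracket α a b := by
  have h : ∃ r : (Cₛ^∞⟮I; F, V⟯ × C^∞⟮I, M; ℝ⟯) × (Cₛ^∞⟮I; F, V⟯ × C^∞⟮I, M; ℝ⟯),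
      affineDiff α a = diffAt (dualModel I F) (fun β => linearFun r.1.1 β + r.1.2 β.1) α ∧
      affineDiff α b = diffAt (dualModel I F) (fun β => linearFun r.2.1 β + r.2.2 β.1) α :=
    ⟨(a, b), rfl, rfl⟩
  rw [liePoisson, dif_pos h]
  obtain ⟨h1, h2⟩ := h.choose_spec
  set r := h.choose
  have h1' : affineDiff α (r.1 - a) = 0 := by
    rw [map_sub, h1]
    exact sub_self _
  have h2' : affineDiff α (r.2 - b) = 0 := by
    rw [map_sub, h2]
    exact sub_self _
  have e1 := A.affineBracket_eq_zero h1' r.2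
  have e2 := A.affineBracket_eq_zero h2' a
  rw [affineBracket_skew, neg_eq_zero, map_sub, LinearMap.sub_apply] at e1
  rw [map_sub] at e2
  change A.affineBracket α r.1 r.2 = _
  linarith

end LieAlgebroid

variable [I.Boundaryless]

theorem affineDiff_surjective (α : DualTotal F V) :
    Function.Surjective (affineDiff (I := I) α) := by
  intro φ
  obtain ⟨a, ha⟩ := exists_affineFun_eventuallyEq (I := I) α φ
  refine ⟨a, ?_⟩
  change diffAt (dualModel I F) (affineFun a) α = φ
  rw [diffAt_eq_fderiv (mdifferentiableAt_affineFun a α)]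
  have h : affineFun a ∘ (extChartAt (dualModel I F) α).symm
      =ᶠ[𝓝 (extChartAt (dualModel I F) α α)] fun z : E × (F →L[ℝ] ℝ) => φ z := by
    have h1 := (continuousAt_extChartAt_symm (I := dualModel I F) α).tendsto
    rw [extChartAt_to_inv] at h1
    filter_upwards [h1.eventually ha, (isOpen_extChartAt_target (I := dualModel I F) α).mem_nhds
      (mem_extChartAt_target α)] with z hz hzt
    rw [Function.comp_apply, hz, (extChartAt (dualModel I F) α).right_inv hzt]
    rfl
  rw [h.fderiv_eq]
  exact ContinuousLinearMap.fderiv (f := (φ : E × (F →L[ℝ] ℝ) →L[ℝ] ℝ))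

theorem LieAlgebroid.liePoisson_bilinear (A : LieAlgebroid I F V) (α : DualTotal F V) :
    ∃ B : Cotangent (dualModel I F) α →ₗ[ℝ] Cotangent (dualModel I F) α →ₗ[ℝ] ℝ,
      ∀ φ ψ, A.liePoisson α φ ψ = B φ ψ := by
  obtain ⟨s, hs⟩ := (affineDiff (I := I) α).exists_rightInverse_of_surjective
    (LinearMap.range_eq_top.2 (affineDiff_surjective α))
  refine ⟨(A.affineBracket α).compl₁₂ s s, fun φ ψ => ?_⟩
  have h : ∀ φ, affineDiff α (s φ) = φ := fun φ => LinearMap.congr_fun hs φ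
  conv_lhs => rw [← h φ, ← h ψ, A.liePoisson_affineDiff]
  rfl

end LiePoisson

/-! ### The vertical vector field of a 1-form -/

section VerticalField

variable {E : Type*} [NormedAddCommGroup E] [NormedSpace ℝ E]
  {H : Type*} [TopologicalSpace H] {I : ModelWithCorners ℝ E H}
  {M : Type*} [TopologicalSpace M] [ChartedSpace H M] [IsManifold I ∞ M]
  {F : Type*} [NormedAddCommGroup F] [NormedSpace ℝ F]
  {V : M → Type*} [TopologicalSpace (Bundle.TotalSpace F V)]
  [∀ x, AddCommGroup (V x)] [∀ x, Module ℝ (V x)] [∀ x, TopologicalSpace (V x)]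
  [FiberBundle F V] [VectorBundle ℝ F V]

namespace LieAlgebroid

variable (A : LieAlgebroid I F V)

theorem contMDiff_anchor_apply (u : Cₛ^∞⟮I; F, V⟯) :
    ContMDiff I I.tangent ∞ (fun y => (⟨y, A.anchor y (u y)⟩ : TangentBundle I M)) :=
  ContMDiff.clm_bundle_apply (F₁ := F) (F₂ := E) (E₁ := V) (E₂ := fun x : M => TangentSpace I x)
    A.anchor.contMDiff u.contMDiff

/-- The function `ρ(u) f`. -/
noncomputable def anchorDeriv (u : Cₛ^∞⟮I; F, V⟯) (f : C^∞⟮I, M; ℝ⟯) : C^∞⟮I, M; ℝ⟯ where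
  val x := diffAt I f x (A.anchor x (u x))
  property := by
    have h : ContMDiff I 𝓘(ℝ, ℝ).tangent ∞ (fun x => tangentMap I 𝓘(ℝ, ℝ) f
        (⟨x, A.anchor x (u x)⟩ : TangentBundle I M)) :=
      (f.contMDiff.contMDiff_tangentMap (by simp)).comp (A.contMDiff_anchor_apply u)
    exact (contMDiff_snd_tangentBundle_modelSpace ℝ 𝓘(ℝ, ℝ)).comp h

/-- The function `γ(ρ u)`. -/
noncomputable def anchorPairing (γ : OneForm I M) (u : Cₛ^∞⟮I; F, V⟯) : C^∞⟮I, M; ℝ⟯ where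
  val x := γ x (A.anchor x (u x))
  property x := γ.contMDiffAt_apply (A.contMDiff_anchor_apply u x)

theorem affineDiff_verticalField (γ : OneForm I M) (α : DualTotal F V)
    (a : Cₛ^∞⟮I; F, V⟯ × C^∞⟮I, M; ℝ⟯) :
    affineDiff α a (A.verticalField γ α) = -γ α.1 (A.anchor α.1 (a.1 α.1)) :=
  diffAt_affineFun_verticalLine a α (A.anchorDual α.1 (γ α.1))

theorem derivAlong_verticalField_affineFun (γ : OneForm I M)
    (a : Cₛ^∞⟮I; F, V⟯ × C^∞⟮I, M; ℝ⟯) :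
    derivAlong (dualModel I F) (A.verticalField γ) (affineFun a) =
      affineFun (0, -A.anchorPairing γ a.1) := by
  funext α
  refine (A.affineDiff_verticalField γ α a).trans ?_
  simp only [affineFun, linearFun, ContMDiffSection.coe_zero, Pi.zero_apply, map_zero, zero_add]
  rfl

variable [FiniteDimensional ℝ E] [T2Space M] [FiniteDimensional ℝ F] [ContMDiffVectorBundle ∞ F V I]

theorem liePoisson_diffAt_affineFun (a b : Cₛ^∞⟮I; F, V⟯ × C^∞⟮I, M; ℝ⟯) :
    (fun α => A.liePoisson α (diffAt (dualModel I F) (affineFun a) α)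
      (diffAt (dualModel I F) (affineFun b) α)) =
      affineFun (A.bracket a.1 b.1, A.anchorDeriv a.1 b.2 - A.anchorDeriv b.1 a.2) := by
  funext α
  refine (A.liePoisson_affineDiff α a b).trans ?_
  rw [affineBracket_apply, add_sub_assoc]
  rfl

variable [I.Boundaryless]

/-- On affine functions, `L_{ad(γ)} π` is the pullback of `dγ` by the anchor. -/
theorem lieDerivBivector_affineFun (γ : OneForm I M) (a b : Cₛ^∞⟮I; F, V⟯ × C^∞⟮I, M; ℝ⟯)
    (α : DualTotal F V) :
    lieDerivBivector (dualModel I F) (A.verticalField γ) A.liePoisson (affineFun a) (affineFun b) α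
      = γ.extDerivAt α.1 (A.anchor α.1 (a.1 α.1)) (A.anchor α.1 (b.1 α.1)) := by
  have hneg : ∀ (u : Cₛ^∞⟮I; F, V⟯) (w : TangentSpace I α.1),
      diffAt I (-A.anchorPairing γ u : C^∞⟮I, M; ℝ⟯) α.1 w =
        -diffAt I (fun y => (γ y (A.anchor y (u y)) : ℝ)) α.1 w := fun u w =>
    DFunLike.congr_fun (diffAt_neg (J := I) (f := fun y => (γ y (A.anchor y (u y)) : ℝ))) w
  have h1 := A.liePoisson_affineDiff α (0, -A.anchorPairing γ a.1) b
  have h2 := A.liePoisson_affineDiff α a (0, -A.anchorPairing γ b.1)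
  simp only [affineBracket_apply, map_zero, LinearMap.zero_apply, ContMDiffSection.coe_zero,
    Pi.zero_apply, hneg, linearFun, zero_add, sub_zero] at h1 h2
  rw [lieDerivBivector, A.liePoisson_diffAt_affineFun, A.derivAlong_verticalField_affineFun,
    A.derivAlong_verticalField_affineFun, A.derivAlong_verticalField_affineFun,
    γ.extDerivAt_apply_vectorField (A.contMDiff_anchor_apply a.1 α.1)
      (A.contMDiff_anchor_apply b.1 α.1), ← A.anchor_bracket]
  have h3 : affineFun (0, -A.anchorPairing γ (A.bracket a.1 b.1)) α =
      -(γ α.1 (A.anchor α.1 (A.bracket a.1 b.1 α.1)) : ℝ) := by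
    simp only [affineFun, linearFun, ContMDiffSection.coe_zero, Pi.zero_apply, map_zero, zero_add]
    rfl
  rw [h3]
  -- `affineDiff` unfolds to `diffAt`, so `h1` and `h2` give the two terms with `π`
  refine (congrArg₂ (fun r s : ℝ => _ - r - s) h1 h2).trans ?_
  ring

theorem isPoissonVectorField_verticalField_iff (γ : OneForm I M) :
    IsPoissonVectorField (dualModel I F) A.liePoisson (A.verticalField γ) ↔
      ∀ (x : M) (a b : V x), γ.extDerivAt x (A.anchor x a) (A.anchor x b) = 0 := by
  refine ⟨fun h x a b => ?_, fun h G K α => ?_⟩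
  · obtain ⟨u, rfl⟩ := exists_section_apply_eq I (F := F) x a
    obtain ⟨v, rfl⟩ := exists_section_apply_eq I (F := F) x b
    -- the Lie derivative of `π` on affine functions is constant along the fibres
    let α : DualTotal F V := ⟨x, 0⟩
    exact (A.lieDerivBivector_affineFun γ (u, 0) (v, 0) α).symm.trans
      (h ⟨affineFun (u, 0), contMDiff_affineFun _⟩ ⟨affineFun (v, 0), contMDiff_affineFun _⟩ α)
  · let b := finBasis ℝ (E × (F →L[ℝ] ℝ))
    choose a ha using fun k => exists_affineFun_eventuallyEq (I := I) α
      ((ContinuousLinearMap.proj k).comp b.equivFunL.toContinuousLinearMap)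
    refine lieDerivBivector_eq_zero_of_coordinates A.liePoisson_bilinear b
      (y := fun k => affineFun (a k)) ha (fun k l => ?_) (fun k => ?_) (fun k l => ?_) G K
    · rw [A.liePoisson_diffAt_affineFun]
      exact mdifferentiableAt_affineFun _ _
    · rw [A.derivAlong_verticalField_affineFun]
      exact mdifferentiableAt_affineFun _ _
    · rw [A.lieDerivBivector_affineFun]
      exact h _ _ _

theorem isHamiltonianVectorField_verticalField_iff (γ : OneForm I M) :
    IsHamiltonianVectorField (dualModel I F) A.liePoisson (A.verticalField γ) ↔
      ∃ f : C^∞⟮I, M; ℝ⟯, ∀ x : M, A.anchorDual x (γ x) = A.anchorDual x (diffAt I f x) := by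
  constructor
  · rintro ⟨K, hK⟩
    let z : M → DualTotal F V := Bundle.zeroSection (F →L[ℝ] ℝ) _
    have hz : ContMDiff I (dualModel I F) ∞ z := Bundle.contMDiff_zeroSection ℝ _
    refine ⟨⟨fun x => K (z x), K.contMDiff.comp hz⟩, fun x => ?_⟩
    ext a
    obtain ⟨v, rfl⟩ := exists_section_apply_eq I (F := F) x a
    obtain ⟨⟨u, h⟩, huh⟩ := affineDiff_surjective (I := I) (z x) (diffAt (dualModel I F) K (z x))
    have h1 := hK (z x) (affineDiff (z x) (v, 0))
    rw [← huh, A.liePoisson_affineDiff, A.affineDiff_verticalField, affineBracket_apply] at h1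
    -- linear functions vanish on the zero section
    have h2 : linearFun (A.bracket u v) (z x) = 0 := rfl
    have h3 : diffAt I (0 : C^∞⟮I, M; ℝ⟯) x = 0 := diffAt_const 0
    -- `K` and `l_u + p*h` have the same differential at `z x`, and `l_u` vanishes along `z`
    have h4 : diffAt I (fun y => K (z y)) x (A.anchor x (v x)) =
        diffAt I h x (A.anchor x (v x)) := by
      rw [diffAt_comp_apply (K.contMDiff.mdifferentiableAt (by simp))
        (hz.mdifferentiableAt (by simp)), ← huh]
      refine (diffAt_comp_apply (mdifferentiableAt_affineFun (u, h) _)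
        (hz.mdifferentiableAt (by simp)) _).symm.trans ?_
      have : (fun y => affineFun (u, h) (z y)) = h := by
        funext y
        exact zero_add _
      rw [this]
    change -(γ x (A.anchor x (v x)) : ℝ) = linearFun (A.bracket u v) (z x) +
      diffAt I (0 : C^∞⟮I, M; ℝ⟯) x (A.anchor x (u x)) - diffAt I h x (A.anchor x (v x)) at h1
    rw [h2, h3, zero_apply, add_zero, zero_sub, neg_inj] at h1
    exact h1.trans h4.symm
  · rintro ⟨f, hf⟩
    refine ⟨⟨affineFun (0, f), contMDiff_affineFun _⟩, fun α ψ => ?_⟩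
    obtain ⟨b, rfl⟩ := affineDiff_surjective (I := I) α ψ
    refine Eq.trans ?_ (A.liePoisson_affineDiff α (0, f) b).symm
    rw [A.affineDiff_verticalField, affineBracket_apply]
    have := DFunLike.congr_fun (hf α.1) (b.1 α.1)
    simp only [map_zero, LinearMap.zero_apply, linearFun, ContMDiffSection.coe_zero,
      Pi.zero_apply, zero_add, zero_sub]
    exact congrArg Neg.neg this

end LieAlgebroid

end VerticalField

theorem proposition3p3
    {E : Type*} [NormedAddCommGroup E] [NormedSpace ℝ E] [FiniteDimensional ℝ E]
    {H : Type*} [TopologicalSpace H] (I : ModelWithCorners ℝ E H) [I.Boundaryless]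
    {M : Type*} [TopologicalSpace M] [ChartedSpace H M] [IsManifold I ∞ M] [T2Space M]
    {F : Type*} [NormedAddCommGroup F] [NormedSpace ℝ F] [FiniteDimensional ℝ F]
    {V : M → Type*} [TopologicalSpace (Bundle.TotalSpace F V)]
    [∀ x, AddCommGroup (V x)] [∀ x, Module ℝ (V x)] [∀ x, TopologicalSpace (V x)]
    [FiberBundle F V] [VectorBundle ℝ F V] [ContMDiffVectorBundle ∞ F V I]
    (A : LieAlgebroid I F V) (γ : OneForm I M) :
    (IsPoissonVectorField (dualModel I F) A.liePoisson (A.verticalField γ) ↔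
        ∀ (x : M) (a b : V x), γ.extDerivAt x (A.anchor x a) (A.anchor x b) = 0) ∧
    (IsHamiltonianVectorField (dualModel I F) A.liePoisson (A.verticalField γ) ↔
        ∃ f : C^∞⟮I, M; ℝ⟯, ∀ x : M,
          A.anchorDual x (γ x) = A.anchorDual x (diffAt I f x)) ∧
    (A.IsTransitive →
      (IsPoissonVectorField (dualModel I F) A.liePoisson (A.verticalField γ) ↔ γ.IsClosed) ∧
      (IsHamiltonianVectorField (dualModel I F) A.liePoisson (A.verticalField γ) ↔
        γ.IsExact)) := by
  refine ⟨A.isPoissonVectorField_verticalField_iff γ,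
    A.isHamiltonianVectorField_verticalField_iff γ,
    fun hA => ⟨(A.isPoissonVectorField_verticalField_iff γ).trans ⟨fun h x v w => ?_,
      fun h x a b => h x _ _⟩, (A.isHamiltonianVectorField_verticalField_iff γ).trans
      (exists_congr fun f => ⟨fun h x v => ?_, fun h x => ?_⟩)⟩⟩
  · obtain ⟨a, rfl⟩ := hA x v
    obtain ⟨b, rfl⟩ := hA x w
    exact h x a b
  · obtain ⟨a, rfl⟩ := hA x v
    exact DFunLike.congr_fun (h x) a
  · ext a
    exact h x _
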